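/- **Systems.** A dynamical system $\Sigma=(X,\xi,x_{\rm in})$ consists of $X\subseteq\mathbb R^n$, $x_{\rm in}\in X$ and a map $\xi$ sending a nonempty set of states and a time $t\in\mathbb R_{\ge0}$ to a nonempty set of states, with $\xi(\mathfrak x,0)=\mathfrak x$ and $\xi(\mathfrak x,t_1+t_2)=\xi(\xi(\mathfrak x,t_1),t_2)$; write $\xi(x,t)=\xi(\{x\},t)$. A trajectory is a map $\sigma:\mathbb R_{\ge0}\to X$ with $\sigma(s+t)\in\xi(\sigma(s),t)$ for all $s,t\ge0$; a finite trajectory $\sigma:[0,T]\to X$ satisfies this for $s+t\le T$. Let $AP$ be a finite set of atomic propositions, $P:X\to2^{AP}$, and $\tau>0$. Standing assumption: along every trajectory $\sigma$ from $x_{\rm in}$, for all $p,p'\in AP$ and $t\ge 0$, (i) if $0\le t'\le\tau$ and $p$ has the same truth value at $\sigma(t)$ and $\sigma(t+t')$, then it has this value at $\sigma(t+t'')$ for all $t''\in[0,t']$; (ii) if both $p$ and $p'$ have different truth values at $\sigma(t)$ and $\sigma(t+\tau)$, then $p=p'$. **Formulas.** Continuous-time LTL formulas are built from $\top$ and $p\in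 AP$ with $\neg,\wedge,\vee,U,R$ (no "next"). For a signal $\varsigma:\mathbb R_{\ge0}\to2^{AP}$: $\varsigma,t\vDash p$ iff $p\in\varsigma(t)$; Boolean connectives as usual; $\varsigma,t\vDash\phi\,U\,\psi$ iff there is $t'\ge t$ with $\varsigma,t'\vDash\psi$ and $\varsigma,t''\vDash\phi$ for all $t''\in[t,t')$; $\phi\,R\,\psi$ means $\neg(\neg\phi\,U\,\neg\psi)$. The set $\mathrm{sub}(\phi)$ of subformulas contains $\phi$. **Observations.** Let $\mathbb O=\{A,Z,E,N\}$. On $I=[k\tau,(k+1)\tau]$ the observation of $p$ along $\varsigma$ is $A$ if $p$ holds on all of $I$; $N$ if $p$ holds nowhere on $I$; $Z$ (resp. $E$) if $p$ holds (resp. fails) at $k\tau$, fails (resp. holds) at $(k+1)\tau$, and there is $t'\in I$ such that $p$ holds (resp. fails) at all $t\in I$ with $t<t'$ and fails (resp. holds) at all $t\in I$ with $t>t'$. **Symbolic models.** A symbolic model $S=(Q,\delta_s,q_{\rm in})$ with $\delta_s\subseteq Q\times\mathbb O^{AP}\times Q$ soundly represents $\Sigma$ if it comes with $\gamma:X\to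 Q$ and $\rho_Z,\rho_E:Q\times Q\times AP\to\{+,-,?\}$ such that, where $P_Z=\{A,Z\},\{E,N\},\mathbb O$ if $\rho_Z=+,-,?$ and $P_E=\{A,E\},\{Z,N\},\mathbb O$ if $\rho_E=+,-,?$ respectively: (1) $q_{\rm in}=\gamma(x_{\rm in})$; (2) for all $x\in X$ and $x'\in\xi(x,\tau)$ there is $o$ with $(\gamma(x),o,\gamma(x'))\in\delta_s$; (3) for every finite trajectory $\sigma:[0,\tau]\to X$ from $x$ to $x'$ and every $p$, the observation of $p$ along $P\circ\sigma$ on $[0,\tau]$, when it exists, lies in $(P_Z\cap P_E)(\gamma(x),\gamma(x'),p)$; (4) if $q=\gamma(x)$ and $q'=\gamma(x')$ for some $x\in X$, $x'\in\xi(x,\tau)$, then $(q,o,q')\in\delta_s$ for every $o:AP\to\mathbb O$ with $o(p)\in (P_Z\cap P_E)(q,q',p)$ for all $p$. **Automata.** A valuation $\nu:\mathrm{sub}(\phi)\to\mathbb O$ is consistent if $\nu(\top)=A$; $\nu(\neg\psi)$ is obtained from $\nu(\psi)$ by exchanging $A\leftrightarrow N$ and $Z\leftrightarrow E$; and for $\odot\in\{\wedge,\vee,U,R\}$,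 $\nu(\psi_1\odot\psi_2)\in c_\odot(\nu(\psi_1),\nu(\psi_2))$, where, with $\nu(\psi_2)=A,Z,E,N$ in this order ($AZ$ means $\{A,Z\}$, etc.): - $\nu(\psi_1)=A$: $c_\wedge$: $A,Z,E,N$; $c_\vee$: $A,A,A,A$; $c_U$: $A,AZ,A,AN$; $c_R$: $A,Z,E,N$. - $\nu(\psi_1)=Z$: $c_\wedge$: $Z,Z,N,N$; $c_\vee$: $A,Z,A,Z$; $c_U$: $A,Z,A,N$; $c_R$: $AZ,Z,EN,N$. - $\nu(\psi_1)=E$: $c_\wedge$: $E,N,E,N$; $c_\vee$: $A,A,E,E$; $c_U$: $A,AZ,E,EN$; $c_R$: $A,N,E,N$. - $\nu(\psi_1)=N$: $c_\wedge$: $N,N,N,N$; $c_\vee$: $A,Z,E,N$; $c_U$: $A,Z,E,N$; $c_R$: $AN,N,EN,N$. The generalized automaton $\mathcal A_\phi$ has as states the consistent valuations and an initial state $q_0$. It has a transition $(\nu,o,\nu')$ iff $\nu'(p)=o(p)$ for all $p\in AP\cap\mathrm{sub}(\phi)$ and, for all $\psi\in\mathrm{sub}(\phi)$, $\nu(\psi)\in\{A,E\}\iff\nu'(\psi)\in\{A,Z\}$;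 and a transition $(q_0,o,\nu')$ iff $\nu'(p)=o(p)$ for all $p\in AP\cap\mathrm{sub}(\phi)$ and $\nu'(\phi)\in\{A,Z\}$. Its accepting sets are $F_{\psi_1U\psi_2}=\{\nu:\nu(\psi_2)\ne N\text{ or }\nu(\psi_1U\psi_2)\ne A\}$ and $F_{\psi_1R\psi_2}=\{\nu:\nu(\psi_2)\ne A\text{ or }\nu(\psi_1R\psi_2)\ne N\}$, for the until and release subformulas of $\phi$. List them as $F_0,\dots,F_{r-1}$. The Büchi automaton $\mathcal B_\phi=(B,\delta_b,b_{\rm in},F)$ is the usual translation of $\mathcal A_\phi$: states $(a,j)$ with $0\le j\le r$, initial state $(q_0,0)$, accepting states those with $j=r$, and $((a,j),o,(a',j'))\in\delta_b$ iff $(a,o,a')$ is a transition of $\mathcal A_\phi$ and, with $i=0$ if $j=r$ and $i=j$ otherwise, $j'$ is the largest $j'\in\{i,\dots,r\}$ with $a'\in F_k$ for all $i\le k<j'$. **Game.** In the Büchi game $G_{S\times\mathcal B_\phi}$ Opponent owns the vertices $(q,b)$ and Player the vertices $(q,o,b)$, with $q\in Q$, $b\in B$, $o\in\mathbb O^{AP}$.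 The edges are $(q,b)\to(q',o,b)$ for $(q,o,q')\in\delta_s$ and $(q,o,b)\to(q,b')$ for $(b,o,b')\in\delta_b$. The initial vertex is $(q_{\rm in},b_{\rm in})$. A (positional) strategy picks a successor at each vertex of its owner that has one. Player wins a play if it is infinite and visits $\{(q,b):b\in F\}$ infinitely often, or if it ends at an Opponent vertex without successors; Player loses a play that ends at a Player vertex without successors. The game is winning if some Player strategy wins, from the initial vertex, against every Opponent strategy. **Statement.** Let $\Sigma$, $P$, $\tau$ be as above, let $S$ soundly represent $\Sigma$, and let $\phi$ be a continuous-time LTL formula. If some $p\in AP$ occurs in $\phi$ both under an even and under an odd number of negations, assume for each such $p$ that along every trajectory $\sigma$ of $\Sigma$ from $x_{\rm in}$ the truth value of $p$ at $\sigma(t)$ is right-continuous in $t$. If $G_{S\times\mathcal B_\phi}$ is winning, then $P\circ\sigma,0\vDash\phi$ for every trajectory $\sigma$ of $\Sigma$ from $x_{\rm in}$. -/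

import Mathlib

open Set Filter Topology
open scoped NNReal

namespace APObs

universe u v w

/-! ### Dynamical systems -/

/-- A nondeterministic dynamical system `(X, ξ, x_in)` with `X ⊆ ℝⁿ`; the evolution function `evol`
sends a nonempty set of states and a time to a nonempty set of states. -/
structure DynSystem (n : ℕ) where
  X : Set (Fin n → ℝ)
  evol : {s : Set X // s.Nonempty} → ℝ≥0 → {s : Set X // s.Nonempty}
  start : X
  evol_zero : ∀ s, evol s 0 = s
  evol_add : ∀ s t₁ t₂, evol s (t₁ + t₂) = evol (evol s t₁) t₂

namespace DynSystem

variable {n : ℕ} (D : DynSystem n)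

/-- The states reachable from the single state `x` at time `t`. -/
def reach (x : D.X) (t : ℝ≥0) : Set D.X :=
  (D.evol ⟨{x}, Set.singleton_nonempty x⟩ t : Set D.X)

/-- Trajectories: at all times `s`, `s + t` the state `σ (s + t)` is one that
the system can reach from `σ s` in time `t`. -/
def IsTrajectory (σ : ℝ≥0 → D.X) : Prop :=
  ∀ s t, σ (s + t) ∈ D.reach (σ s) t

/-- Finite trajectories on `[0, T]`; the values of `σ` after time `T` are irrelevant. -/
def IsFiniteTrajectory (T : ℝ≥0) (σ : ℝ≥0 → D.X) : Prop :=
  ∀ s t, s + t ≤ T → σ (s + t) ∈ D.reach (σ s) t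

/-- The trajectories that start in the initial state. -/
def Traj : Set (ℝ≥0 → D.X) :=
  {σ | D.IsTrajectory σ ∧ σ 0 = D.start}

end DynSystem

/-! ### Continuous-time LTL -/

/-- Continuous-time LTL formulas (no "next" operator). Conjunction and release are kept as
connectives of their own, because subformula valuations are constrained at these connectives. -/
inductive Formula (AP : Type u) : Type u where
  | top : Formula AP
  | atom (p : AP) : Formula AP
  | neg (a : Formula AP) : Formula AP
  | and (a b : Formula AP) : Formula AP
  | or (a b : Formula AP) : Formula AP
  | untl (a b : Formula AP) : Formula AP
  | release (a b : Formula AP) : Formula AP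

/-- The signal semantics `ς, t ⊨ φ`, for an AP-signal `ς : ℝ≥0 → 2^AP`. -/
def Sat {AP : Type u} (ς : ℝ≥0 → Set AP) : Formula AP → ℝ≥0 → Prop
  | .top, _ => True
  | .atom p, t => p ∈ ς t
  | .neg a, t => ¬ Sat ς a t
  | .and a b, t => Sat ς a t ∧ Sat ς b t
  | .or a b, t => Sat ς a t ∨ Sat ς b t
  | .untl a b, t => ∃ t', t ≤ t' ∧ Sat ς b t' ∧ ∀ t'', t ≤ t'' → t'' < t' → Sat ς a t''
  | .release a b, t =>
      ¬ ∃ t', t ≤ t' ∧ ¬ Sat ς b t' ∧ ∀ t'', t ≤ t'' → t'' < t' → ¬ Sat ς a t''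

namespace Formula

variable {AP : Type u}

/-- The subformulas of a formula (the formula itself included). -/
def sub : Formula AP → List (Formula AP)
  | .top => [.top]
  | .atom p => [.atom p]
  | .neg a => .neg a :: a.sub
  | .and a b => .and a b :: (a.sub ++ b.sub)
  | .or a b => .or a b :: (a.sub ++ b.sub)
  | .untl a b => .untl a b :: (a.sub ++ b.sub)
  | .release a b => .release a b :: (a.sub ++ b.sub)

theorem self_mem_sub (φ : Formula AP) : φ ∈ φ.sub := by
  cases φ <;> simp [sub]

/-- `φ.Occurs true p`: the proposition `p` has an occurrence in `φ` under an even number of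
negations; `φ.Occurs false p`: under an odd number. -/
def Occurs : Formula AP → Bool → AP → Prop
  | .top, _, _ => False
  | .atom q, s, p => s = true ∧ q = p
  | .neg a, s, p => a.Occurs (!s) p
  | .and a b, s, p => a.Occurs s p ∨ b.Occurs s p
  | .or a b, s, p => a.Occurs s p ∨ b.Occurs s p
  | .untl a b, s, p => a.Occurs s p ∨ b.Occurs s p
  | .release a b, s, p => a.Occurs s p ∨ b.Occurs s p

end Formula

/-! ### Observations and signal chopping -/

/-- The four observations: true at All times, true at time Zero (then false),
true at the End (false before), true at No time. -/
inductive Obs : Type where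
  | A | Z | E | N

instance : Finite Obs :=
  Finite.of_surjective (fun i : Fin 4 => (![Obs.A, Obs.Z, Obs.E, Obs.N] : Fin 4 → Obs) i) (by
    intro o
    cases o
    · exact ⟨0, rfl⟩
    · exact ⟨1, rfl⟩
    · exact ⟨2, rfl⟩
    · exact ⟨3, rfl⟩)

/-- `HasObs ς τ k p o`: on `[kτ, (k+1)τ]` the observation of `p` along the signal `ς` is `o`.
For `Z` and `E` the truth value changes exactly once inside the interval, at some instant `t'`;
the value at the instant `t'` itself may be the old or the new one. -/
def HasObs {AP : Type u} (ς : ℝ≥0 → Set AP) (τ : ℝ≥0) (k : ℕ) (p : AP) : Obs → Prop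
  | .A => ∀ t ∈ Icc (k * τ) ((k + 1) * τ), p ∈ ς t
  | .Z => p ∈ ς (k * τ) ∧ p ∉ ς ((k + 1) * τ) ∧
      ∃ t' ∈ Icc (k * τ) ((k + 1) * τ), ∀ t ∈ Icc (k * τ) ((k + 1) * τ),
        (t < t' → p ∈ ς t) ∧ (t' < t → p ∉ ς t)
  | .E => p ∉ ς (k * τ) ∧ p ∈ ς ((k + 1) * τ) ∧
      ∃ t' ∈ Icc (k * τ) ((k + 1) * τ), ∀ t ∈ Icc (k * τ) ((k + 1) * τ),
        (t < t' → p ∉ ς t) ∧ (t' < t → p ∈ ς t)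
  | .N => ∀ t ∈ Icc (k * τ) ((k + 1) * τ), p ∉ ς t

/-- The standing assumption on an AP-signal and the sampling time `τ`: within time `τ` no
proposition changes its truth value and changes it back, and at most one proposition changes. -/
structure Separated {AP : Type u} (ς : ℝ≥0 → Set AP) (τ : ℝ≥0) : Prop where
  no_return : ∀ (p : AP) (t t' : ℝ≥0), t' ≤ τ → (p ∈ ς t ↔ p ∈ ς (t + t')) →
    ∀ t'' ≤ t', (p ∈ ς t ↔ p ∈ ς (t + t''))
  one_change : ∀ (p p' : AP) (t : ℝ≥0), ¬ (p ∈ ς t ↔ p ∈ ς (t + τ)) →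
    ¬ (p' ∈ ς t ↔ p' ∈ ς (t + τ)) → p = p'

/-- The truth value of `p` along `ς` is right-continuous at time `t`. -/
def RightContinuousAt {AP : Type u} (ς : ℝ≥0 → Set AP) (p : AP) (t : ℝ≥0) : Prop :=
  ∀ᶠ s in 𝓝[>] t, (p ∈ ς s ↔ p ∈ ς t)

/-! ### Symbolic models -/

/-- A symbolic model: a transition system with labels in `Obs^AP`. -/
structure SymbolicModel (AP : Type u) (Q : Type v) where
  trans : Set (Q × (AP → Obs) × Q)
  start : Q

/-- The values `+`, `-`, `?` of the functions `ρ_Z` and `ρ_E`. -/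
inductive Approx : Type where
  | plus | minus | unknown

/-- The set `P_Z`, as a function of the value of `ρ_Z`. -/
def Approx.atZero : Approx → Set Obs
  | .plus => {Obs.A, Obs.Z}
  | .minus => {Obs.E, Obs.N}
  | .unknown => Set.univ

/-- The set `P_E`, as a function of the value of `ρ_E`. -/
def Approx.atEnd : Approx → Set Obs
  | .plus => {Obs.A, Obs.E}
  | .minus => {Obs.Z, Obs.N}
  | .unknown => Set.univ

/-- The symbolic model `S`, with abstraction map `γ` and functions `ρZ`, `ρE`, soundly represents
the system `D` with labelling `P` at sampling time `τ`. -/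
structure Represents {n : ℕ} {AP : Type u} {Q : Type v} (D : DynSystem n) (P : D.X → Set AP)
    (τ : ℝ≥0) (S : SymbolicModel AP Q) (γ : D.X → Q) (ρZ ρE : Q → Q → AP → Approx) : Prop where
  start_eq : S.start = γ D.start
  simulation : ∀ x, ∀ x' ∈ D.reach x τ, ∃ o, (γ x, o, γ x') ∈ S.trans
  obs_sound : ∀ σ : ℝ≥0 → D.X, D.IsFiniteTrajectory τ σ → ∀ p o,
    HasObs (fun t => P (σ t)) τ 0 p o →
      o ∈ (ρZ (γ (σ 0)) (γ (σ τ)) p).atZero ∩ (ρE (γ (σ 0)) (γ (σ τ)) p).atEnd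
  trans_complete : ∀ q q', (∃ x, ∃ x' ∈ D.reach x τ, γ x = q ∧ γ x' = q') →
    ∀ o : AP → Obs, (∀ p, o p ∈ (ρZ q q' p).atZero ∩ (ρE q q' p).atEnd) → (q, o, q') ∈ S.trans

/-! ### AP-observation automata -/

/-- An AP-observation automaton (finiteness of `B` is proved for the automata used here). -/
structure ObsAutomaton (AP : Type u) (B : Type v) where
  trans : Set (B × (AP → Obs) × B)
  start : B
  final : Set B

/-- A generalized AP-observation automaton; the accepting sets are given as a list. -/
structure GenObsAutomaton (AP : Type u) (B : Type v) where
  trans : Set (B × (AP → Obs) × B)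
  start : B
  final : List (Set B)

/-- The standard translation of a generalized Büchi automaton with accepting sets
`F_0, …, F_{r-1}` into a Büchi automaton. The second component of a state is a counter in
`{0, …, r}`: on entering `a'` it goes (from `0` if its value was `r`) past all the consecutive
indices `k` with `a' ∈ F_k`; a state is accepting if the counter is `r`. -/
def GenObsAutomaton.toBuchi {AP : Type u} {B : Type v} (M : GenObsAutomaton AP B) :
    ObsAutomaton AP (B × Fin (M.final.length + 1)) where
  trans := {e | (e.1.1, e.2.1, e.2.2.1) ∈ M.trans ∧
    ∃ i : ℕ, i = (if e.1.2.val = M.final.length then 0 else e.1.2.val) ∧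
      i ≤ e.2.2.2.val ∧
      ∀ (k : ℕ) (hk : k < M.final.length),
        (i ≤ k → k < e.2.2.2.val → e.2.2.1 ∈ M.final[k]) ∧
        (k = e.2.2.2.val → e.2.2.1 ∉ M.final[k])}
  start := (M.start, 0)
  final := {b | b.2.val = M.final.length}

/-! ### The automaton of a formula -/

namespace Obs

/-- Consistency rule for negation. -/
def cNeg : Obs → Obs
  | A => N
  | Z => E
  | E => Z
  | N => A

/-- Consistency rule for conjunction. -/
def cAnd : Obs → Obs → Set Obs
  | A, o => {o}
  | Z, A => {Z}
  | Z, Z => {Z}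
  | Z, E => {N}
  | Z, N => {N}
  | E, A => {E}
  | E, Z => {N}
  | E, E => {E}
  | E, N => {N}
  | N, _ => {N}

/-- Consistency rule for disjunction. -/
def cOr : Obs → Obs → Set Obs
  | A, _ => {A}
  | Z, A => {A}
  | Z, Z => {Z}
  | Z, E => {A}
  | Z, N => {Z}
  | E, A => {A}
  | E, Z => {A}
  | E, E => {E}
  | E, N => {E}
  | N, o => {o}

/-- Consistency rule for until. -/
def cUntil : Obs → Obs → Set Obs
  | A, A => {A}
  | A, Z => {A, Z}
  | A, E => {A}
  | A, N => {A, N}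
  | Z, A => {A}
  | Z, Z => {Z}
  | Z, E => {A}
  | Z, N => {N}
  | E, A => {A}
  | E, Z => {A, Z}
  | E, E => {E}
  | E, N => {E, N}
  | N, A => {A}
  | N, Z => {Z}
  | N, E => {E}
  | N, N => {N}

/-- Consistency rule for release. -/
def cRelease : Obs → Obs → Set Obs
  | A, A => {A}
  | A, Z => {Z}
  | A, E => {E}
  | A, N => {N}
  | Z, A => {A, Z}
  | Z, Z => {Z}
  | Z, E => {E, N}
  | Z, N => {N}
  | E, A => {A}
  | E, Z => {N}
  | E, E => {E}
  | E, N => {N}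
  | N, A => {A, N}
  | N, Z => {N}
  | N, E => {E, N}
  | N, N => {N}

end Obs

namespace Formula

variable {AP : Type u}

/-- Subformula valuations of `φ`. -/
abbrev Valuation (φ : Formula AP) : Type u := {ψ : Formula AP // ψ ∈ φ.sub} → Obs

/-- Consistent subformula valuations. -/
structure Consistent (φ : Formula AP) (ν : φ.Valuation) : Prop where
  top : ∀ h : Formula.top ∈ φ.sub, ν ⟨.top, h⟩ = Obs.A
  neg : ∀ (a : Formula AP) (ha : a ∈ φ.sub) (h : a.neg ∈ φ.sub),
    ν ⟨a.neg, h⟩ = (ν ⟨a, ha⟩).cNeg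
  and : ∀ (a b : Formula AP) (ha : a ∈ φ.sub) (hb : b ∈ φ.sub) (h : a.and b ∈ φ.sub),
    ν ⟨a.and b, h⟩ ∈ (ν ⟨a, ha⟩).cAnd (ν ⟨b, hb⟩)
  or : ∀ (a b : Formula AP) (ha : a ∈ φ.sub) (hb : b ∈ φ.sub) (h : a.or b ∈ φ.sub),
    ν ⟨a.or b, h⟩ ∈ (ν ⟨a, ha⟩).cOr (ν ⟨b, hb⟩)
  untl : ∀ (a b : Formula AP) (ha : a ∈ φ.sub) (hb : b ∈ φ.sub) (h : a.untl b ∈ φ.sub),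
    ν ⟨a.untl b, h⟩ ∈ (ν ⟨a, ha⟩).cUntil (ν ⟨b, hb⟩)
  release : ∀ (a b : Formula AP) (ha : a ∈ φ.sub) (hb : b ∈ φ.sub) (h : a.release b ∈ φ.sub),
    ν ⟨a.release b, h⟩ ∈ (ν ⟨a, ha⟩).cRelease (ν ⟨b, hb⟩)

/-- States of the generalized automaton: the consistent valuations and, as `none`, the extra
initial state. -/
abbrev GenState (φ : Formula AP) : Type u := Option {ν : φ.Valuation // φ.Consistent ν}

instance (φ : Formula AP) : Finite φ.GenState := by
  have : Finite {ψ : Formula AP // ψ ∈ φ.sub} := List.finite_toSet φ.sub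
  have : Finite φ.Valuation := Pi.finite
  infer_instance

/-- The list of the accepting sets `F_ψ`, over the until and the release subformulas `ψ`. -/
def accepting (φ : Formula AP) : List (Set φ.GenState) :=
  φ.sub.filterMap fun ψ =>
    match ψ with
    | .untl a b => some {s | ∃ ν, s = some ν ∧
        ∀ (hb : b ∈ φ.sub) (h : a.untl b ∈ φ.sub),
          ν.1 ⟨b, hb⟩ ≠ Obs.N ∨ ν.1 ⟨a.untl b, h⟩ ≠ Obs.A}
    | .release a b => some {s | ∃ ν, s = some ν ∧
        ∀ (hb : b ∈ φ.sub) (h : a.release b ∈ φ.sub),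
          ν.1 ⟨b, hb⟩ ≠ Obs.A ∨ ν.1 ⟨a.release b, h⟩ ≠ Obs.N}
    | _ => none

/-- The transitions of the generalized automaton of `φ`. -/
def genTrans (φ : Formula AP) : φ.GenState → (AP → Obs) → φ.GenState → Prop
  | some ν, o, some ν' =>
      (∀ (p : AP) (h : Formula.atom p ∈ φ.sub), ν'.1 ⟨.atom p, h⟩ = o p) ∧
      ∀ ψ, (ν.1 ψ = Obs.A ∨ ν.1 ψ = Obs.E) ↔ (ν'.1 ψ = Obs.A ∨ ν'.1 ψ = Obs.Z)
  | none, o, some ν' =>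
      (∀ (p : AP) (h : Formula.atom p ∈ φ.sub), ν'.1 ⟨.atom p, h⟩ = o p) ∧
      (ν'.1 ⟨φ, φ.self_mem_sub⟩ = Obs.A ∨ ν'.1 ⟨φ, φ.self_mem_sub⟩ = Obs.Z)
  | _, _, none => False

/-- The generalized AP-observation automaton of `φ`. -/
def genAutomaton (φ : Formula AP) : GenObsAutomaton AP φ.GenState where
  trans := {e | φ.genTrans e.1 e.2.1 e.2.2}
  start := none
  final := φ.accepting

/-- The AP-observation automaton `B_φ` of `φ`. -/
def automaton (φ : Formula AP) :
    ObsAutomaton AP (φ.GenState × Fin (φ.genAutomaton.final.length + 1)) :=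
  φ.genAutomaton.toBuchi

end Formula

/-! ### Büchi games -/

/-- A Büchi game; the vertices outside `player` belong to Opponent. -/
structure BuchiGame (V : Type w) where
  player : Set V
  edge : V → V → Prop
  final : Set V
  start : V

namespace BuchiGame

variable {V : Type w} (G : BuchiGame V)

/-- The vertex has no outgoing edge. -/
def Stuck (g : V) : Prop := ∀ g', ¬ G.edge g g'

/-- Player strategies choose a successor of each Player vertex that has one
(the other values of `π` are irrelevant). -/
def IsPlayerStrategy (π : V → V) : Prop :=
  ∀ g ∈ G.player, ¬ G.Stuck g → G.edge g (π g)

/-- Opponent strategies. -/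
def IsOpponentStrategy (π : V → V) : Prop :=
  ∀ g ∉ G.player, ¬ G.Stuck g → G.edge g (π g)

open Classical in
/-- The sequence induced by a Player strategy `π₀` and an Opponent strategy `π₁` from `g`
(meaningful until it reaches a vertex without successors, where the play ends). -/
noncomputable def play (π₀ π₁ : V → V) (g : V) : ℕ → V
  | 0 => g
  | i + 1 =>
      if play π₀ π₁ g i ∈ G.player then π₀ (play π₀ π₁ g i) else π₁ (play π₀ π₁ g i)

/-- Player wins the play: it is infinite and visits `final` infinitely often, or it ends because
Opponent cannot move. -/
def Won (r : ℕ → V) : Prop :=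
  ((∀ i, ¬ G.Stuck (r i)) ∧ ∃ᶠ i in atTop, r i ∈ G.final) ∨
    ∃ i, (∀ j < i, ¬ G.Stuck (r j)) ∧ G.Stuck (r i) ∧ r i ∉ G.player

/-- The game is winning: Player has a winning strategy from the initial vertex. -/
def Winning : Prop :=
  ∃ π₀, G.IsPlayerStrategy π₀ ∧
    ∀ π₁, G.IsOpponentStrategy π₁ → G.Won (G.play π₀ π₁ G.start)

end BuchiGame

/-- The Büchi game `G_{S × B}`. Opponent vertices are `(q, b)`, Player vertices `(q, o, b)`. -/
def productGame {AP : Type u} {Q : Type v} {B : Type w} (S : SymbolicModel AP Q)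
    (M : ObsAutomaton AP B) : BuchiGame ((Q × B) ⊕ (Q × (AP → Obs) × B)) where
  player := Set.range Sum.inr
  edge
    | .inl (q, b), .inr (q', o, b') => (q, o, q') ∈ S.trans ∧ b' = b
    | .inr (q, o, b), .inl (q', b') => (b, o, b') ∈ M.trans ∧ q' = q
    | _, _ => False
  final := {g | ∃ q, ∃ b ∈ M.final, g = .inl (q, b)}
  start := .inl (S.start, M.start)

end APObs

/-!
Fix a trajectory `σ` from the initial state, with signal `ς = P ∘ σ`. Opponent can play along `σ`:
at step `k` she moves to the abstraction of `σ ((k + 1) τ)` and announces the actual observation of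
every proposition on `[kτ, (k + 1)τ]`, which exists because of the separation assumption and is
allowed because the model represents the system soundly. This behaviour is not positional, but a
positional winning strategy of Player also beats it (`BuchiGame.not_reflTransGen_trap`): from a
trap that is bad for Player, a positional Opponent strategy stays in the trap, and elsewhere it
decreases the distance to the trap. So Player answers with an accepting run `ν 0, ν 1, …` of the
automaton of `φ` on the observations of `ς` (`exists_accepting_run`).

It remains to see that on the `k`-th interval every subformula `ψ` has the observation `ν k ψ`
(`sat_iff_holdsOn`). At most one proposition changes there, so the interval is cut into an initial
segment `J` and its complement, and each subformula is true everywhere, nowhere, exactly on `J`, or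
exactly off `J`. The supremum of `J` may belong to either part. For an until formula the true
observation is an element of the consistency table, determined there by the truth value at the right
endpoint (`exists_cUntil_holdsOn`). If `ν k` differs from it, then it is wrong at the right
endpoint, hence so is `ν (k + 1)` at its left endpoint, and the error propagates to all later
intervals. Being wrong at both endpoints of an interval is only possible if there the first argument
is always true and the second always false; then the formula is false and `ν j` claims it true for
all later `j`, contradicting the acceptance condition (`until_iff_holdsOn`). Release formulas follow
by duality.

One entry of the until table (and its dual for release) needs more: if `a` holds exactly on `J` and
`b` exactly off `J`, then `a U b` holds on `J` only if the complement of `J` has a first point. This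
entry occurs only if the changing proposition has occurrences of both polarities
(`Formula.Consistent.occurs`), and then right-continuity is assumed.
-/

namespace APObs

universe u v w

/-! ### Playing against a positional strategy -/

namespace BuchiGame

variable {V : Type w} {G : BuchiGame V} {π₀ : V → V}

/-- The moves that are possible when Player uses the strategy `π₀` (at a Player vertex without
successors the value of `π₀` is irrelevant). -/
def Follows (G : BuchiGame V) (π₀ : V → V) (g g' : V) : Prop :=
  (g ∈ G.player → g' = π₀ g) ∧ (g ∉ G.player → G.edge g g')

/-- The vertices from which `C` can be reached in exactly `m` moves. -/
def layer (G : BuchiGame V) (π₀ : V → V) (C : Set V) : ℕ → Set V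
  | 0 => C
  | m + 1 => {g | ∃ g' ∈ layer G π₀ C m, G.Follows π₀ g g'}

/-- If `π₀` wins, then no sequence of moves against `π₀` enters a trap: a set `C` that Opponent can
keep the play in, where each vertex is either a lost one or outside the final set. -/
theorem not_reflTransGen_trap (hπ₀ : ∀ π₁, G.IsOpponentStrategy π₁ → G.Won (G.play π₀ π₁ G.start))
    {C : Set V} (hfinal : ∀ g ∈ C, ¬ G.Stuck g → g ∉ G.final)
    (hopp : ∀ g ∈ C, g ∉ G.player → ∃ g' ∈ C, G.edge g g')
    (hplayer : ∀ g ∈ C, g ∈ G.player → ¬ G.Stuck g → π₀ g ∈ C)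
    {c : V} (hc : c ∈ C) (hreach : Relation.ReflTransGen (G.Follows π₀) G.start c) : False := by
  classical
  have hlayer : ∃ m, G.start ∈ G.layer π₀ C m := by
    generalize G.start = g at hreach
    induction hreach using Relation.ReflTransGen.head_induction_on with
    | refl => exact ⟨0, hc⟩
    | head h _ ih => exact ⟨ih.choose + 1, _, ih.choose_spec, h⟩
  -- The moves of the positional Opponent strategy: stay in `C`, or approach `C`.
  let good : V → V → Prop := fun g g' => G.edge g g' ∧ (g ∈ C → g' ∈ C) ∧
    (g ∉ C → ∃ m, g' ∈ G.layer π₀ C m ∧ ∀ l, g ∈ G.layer π₀ C l → m < l)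
  have hleast : ∀ g, g ∉ C → (∃ m, g ∈ G.layer π₀ C m) →
      ∃ g' m, g' ∈ G.layer π₀ C m ∧ G.Follows π₀ g g' ∧ ∀ l, g ∈ G.layer π₀ C l → m < l := by
    intro g hg h
    have h1 := Nat.find_spec h
    have h2 : ∀ l, g ∈ G.layer π₀ C l → Nat.find h ≤ l := fun l hl => Nat.find_min' h hl
    generalize Nat.find h = m at h1 h2
    cases m with
    | zero => exact absurd h1 hg
    | succ m =>
      obtain ⟨g', hg', hf⟩ := h1
      exact ⟨g', m, hg', hf, fun l hl => h2 l hl⟩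
  have hgood : ∀ g, g ∉ G.player → (∃ m, g ∈ G.layer π₀ C m) → ∃ g', good g g' := by
    intro g hg h
    by_cases hgC : g ∈ C
    · obtain ⟨g', hg', he⟩ := hopp g hgC hg
      exact ⟨g', he, fun _ => hg', fun h => absurd hgC h⟩
    · obtain ⟨g', m, hg', hf, hm⟩ := hleast g hgC h
      exact ⟨g', hf.2 hg, fun h => absurd h hgC, fun _ => ⟨m, hg', hm⟩⟩
  let π₁ : V → V := fun g =>
    if h : ∃ g', good g g' then h.choose else if h' : ∃ g', G.edge g g' then h'.choose else g
  have hπ₁ : G.IsOpponentStrategy π₁ := by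
    intro g _ hst
    have h' : ∃ g', G.edge g g' := by simpa [Stuck] using hst
    by_cases h : ∃ g', good g g'
    · simp only [π₁, dif_pos h]
      exact h.choose_spec.1
    · simp only [π₁, dif_neg h, dif_pos h']
      exact h'.choose_spec
  have hπ₁good : ∀ g, g ∉ G.player → (∃ m, g ∈ G.layer π₀ C m) → good g (π₁ g) := by
    intro g hg h
    have h' := hgood g hg h
    simp only [π₁, dif_pos h']
    exact h'.choose_spec
  let r := G.play π₀ π₁ G.start
  have hr : ∀ i, r (i + 1) = if r i ∈ G.player then π₀ (r i) else π₁ (r i) := fun i => by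
    simp only [r, play]
  have hstay : ∀ i, ¬ G.Stuck (r i) → r i ∈ C → r (i + 1) ∈ C := by
    intro i hst hi
    rw [hr]
    split_ifs with hp
    · exact hplayer _ hi hp hst
    · exact (hπ₁good _ hp ⟨0, hi⟩).2.1 hi
  have hdescend : ∀ i, r i ∉ C → (∃ m, r i ∈ G.layer π₀ C m) →
      ∃ m, r (i + 1) ∈ G.layer π₀ C m ∧ ∀ l, r i ∈ G.layer π₀ C l → m < l := by
    intro i hi h
    rw [hr]
    split_ifs with hp
    · obtain ⟨g', m, hg', hf, hm⟩ := hleast _ hi h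
      exact ⟨m, hf.1 hp ▸ hg', hm⟩
    · exact (hπ₁good _ hp h).2.2 hi
  have hregion : ∀ i, (∀ j < i, ¬ G.Stuck (r j)) → ∃ m, r i ∈ G.layer π₀ C m := by
    intro i
    induction i with
    | zero => exact fun _ => hlayer
    | succ i ih =>
      intro hst
      by_cases hi : r i ∈ C
      · exact ⟨0, hstay i (hst i (Nat.lt_succ_self i)) hi⟩
      · obtain ⟨m, hm, _⟩ := hdescend i hi (ih fun j hj => hst j (hj.trans (Nat.lt_succ_self i)))
        exact ⟨m, hm⟩
  rcases hπ₀ π₁ hπ₁ with ⟨hst, hfreq⟩ | ⟨i, hst, hi, hp⟩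
  · have henter : ∀ m i, r i ∈ G.layer π₀ C m → ∃ j, r j ∈ C := by
      intro m
      induction m using Nat.strong_induction_on with
      | _ m ih =>
        intro i hi
        by_cases hC : r i ∈ C
        · exact ⟨i, hC⟩
        · obtain ⟨l, hl, hlt⟩ := hdescend i hC ⟨m, hi⟩
          exact ih l (hlt m hi) _ hl
    obtain ⟨N, hN⟩ := henter _ 0 hlayer.choose_spec
    obtain ⟨i, hi, hif⟩ := Filter.frequently_atTop.1 hfreq N
    have hiC : r i ∈ C := by
      clear hif
      induction i, hi using Nat.le_induction with
      | base => exact hN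
      | succ j _ ih => exact hstay j (hst j) ih
    exact hfinal _ hiC (hst i) hif
  · obtain ⟨g', hg'⟩ := hgood _ hp (hregion i hst)
    exact hi g' hg'.1

end BuchiGame

/-! ### The acceptance condition -/

theorem GenObsAutomaton.frequently_mem_final {AP : Type u} {B : Type v}
    {M : GenObsAutomaton AP B} {b : ℕ → B × Fin (M.final.length + 1)} {o : ℕ → AP → Obs}
    (htrans : ∀ i, (b i, o i, b (i + 1)) ∈ M.toBuchi.trans)
    (hfinal : ∃ᶠ i in atTop, b i ∈ M.toBuchi.final)
    {F : Set B} (hF : F ∈ M.final) : ∃ᶠ i in atTop, (b i).1 ∈ F := by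
  obtain ⟨k, hk, rfl⟩ := List.getElem_of_mem hF
  rw [Filter.frequently_atTop] at hfinal ⊢
  intro N
  by_contra! hN
  obtain ⟨i, hi, hbi⟩ := hfinal N
  obtain ⟨i', hi', hbi'⟩ := hfinal (i + 1)
  have hstep : ∀ j, i ≤ j → (if (b j).2.val = M.final.length then 0 else (b j).2.val) ≤ k →
      (b (j + 1)).2.val ≤ k := by
    intro j hj hs
    obtain ⟨_, c, rfl, _, hc⟩ := htrans j
    by_contra! hlt
    exact hN (j + 1) (by omega) ((hc k hk).1 hs hlt)
  -- After the reset at time `i`, the counter cannot get past `k`.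
  have hle : ∀ j, i + 1 ≤ j → (b j).2.val ≤ k := by
    intro j hj
    induction j, hj using Nat.le_induction with
    | base =>
      have hbi : (b i).2.val = M.final.length := hbi
      exact hstep i le_rfl (by rw [if_pos hbi]; exact Nat.zero_le _)
    | succ j hj ih =>
      refine hstep j (by omega) ?_
      split_ifs
      · exact Nat.zero_le _
      · exact ih
  have h1 := hle i' hi'
  have h2 : (b i').2.val = M.final.length := hbi'
  omega

/-! ### Subformulas and polarity -/

namespace Formula

variable {AP : Type u}

theorem sub_trans {a b c : Formula AP} (hab : a ∈ b.sub) (hbc : b ∈ c.sub) : a ∈ c.sub := by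
  induction c <;> simp only [sub, List.mem_cons, List.mem_append, List.not_mem_nil, or_false]
    at hbc ⊢ <;> grind [sub]

theorem mem_sub_of_neg {a φ : Formula AP} (h : a.neg ∈ φ.sub) : a ∈ φ.sub :=
  sub_trans (by simp [sub, self_mem_sub]) h

theorem mem_sub_of_and {a b φ : Formula AP} (h : a.and b ∈ φ.sub) : a ∈ φ.sub ∧ b ∈ φ.sub :=
  ⟨sub_trans (by simp [sub, self_mem_sub]) h, sub_trans (by simp [sub, self_mem_sub]) h⟩

theorem mem_sub_of_or {a b φ : Formula AP} (h : a.or b ∈ φ.sub) : a ∈ φ.sub ∧ b ∈ φ.sub :=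
  ⟨sub_trans (by simp [sub, self_mem_sub]) h, sub_trans (by simp [sub, self_mem_sub]) h⟩

theorem mem_sub_of_untl {a b φ : Formula AP} (h : a.untl b ∈ φ.sub) : a ∈ φ.sub ∧ b ∈ φ.sub :=
  ⟨sub_trans (by simp [sub, self_mem_sub]) h, sub_trans (by simp [sub, self_mem_sub]) h⟩

theorem mem_sub_of_release {a b φ : Formula AP} (h : a.release b ∈ φ.sub) :
    a ∈ φ.sub ∧ b ∈ φ.sub :=
  ⟨sub_trans (by simp [sub, self_mem_sub]) h, sub_trans (by simp [sub, self_mem_sub]) h⟩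

theorem occurs_both_of_mem_sub {ψ φ : Formula AP} (h : ψ ∈ φ.sub) {p : AP}
    (hψ : ∀ s, ψ.Occurs s p) (s : Bool) : φ.Occurs s p := by
  induction φ generalizing s with
  | top => simp only [sub, List.mem_singleton] at h; exact h ▸ hψ s
  | atom q => simp only [sub, List.mem_singleton] at h; exact h ▸ hψ s
  | neg a ih =>
    rcases List.mem_cons.1 h with rfl | h
    · exact hψ s
    · exact ih h _
  | and a b iha ihb | or a b iha ihb | untl a b iha ihb | release a b iha ihb =>
    rcases List.mem_cons.1 h with rfl | h
    · exact hψ s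
    · rcases List.mem_append.1 h with h | h
      · exact Or.inl (iha h s)
      · exact Or.inr (ihb h s)

end Formula

namespace Obs

theorem eq_or_eq_of_mem_cAnd {c x x₁ x₂ : Obs} (hc : c = Z ∨ c = E) (hx : x ∈ cAnd x₁ x₂)
    (h : x = c) : x₁ = c ∨ x₂ = c := by
  subst h
  cases x₁ <;> cases x₂ <;> simp_all [cAnd]

theorem eq_or_eq_of_mem_cOr {c x x₁ x₂ : Obs} (hc : c = Z ∨ c = E) (hx : x ∈ cOr x₁ x₂)
    (h : x = c) : x₁ = c ∨ x₂ = c := by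
  subst h
  cases x₁ <;> cases x₂ <;> simp_all [cOr]

theorem eq_or_eq_of_mem_cUntil {c x x₁ x₂ : Obs} (hc : c = Z ∨ c = E) (hx : x ∈ cUntil x₁ x₂)
    (h : x = c) : x₁ = c ∨ x₂ = c := by
  subst h
  cases x₁ <;> cases x₂ <;> rcases hc with rfl | rfl <;> simp_all [cUntil]

theorem cRelease_eq_cUntil (x₁ x₂ x : Obs) :
    x ∈ cRelease x₁ x₂ ↔ x.cNeg ∈ cUntil x₁.cNeg x₂.cNeg := by
  cases x₁ <;> cases x₂ <;> cases x <;> simp [cRelease, cUntil, cNeg]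

theorem cNeg_cNeg (x : Obs) : x.cNeg.cNeg = x := by
  cases x <;> rfl

theorem eq_or_eq_of_mem_cRelease {c x x₁ x₂ : Obs} (hc : c = Z ∨ c = E)
    (hx : x ∈ cRelease x₁ x₂) (h : x = c) : x₁ = c ∨ x₂ = c := by
  subst h
  cases x₁ <;> cases x₂ <;> rcases hc with rfl | rfl <;> simp_all [cRelease]

end Obs

/-- If `p` is the only proposition that changes, then a consistent valuation gives a changing
observation only to subformulas that contain `p`, and the direction of the change tells the polarity
of an occurrence. -/
theorem Formula.Consistent.occurs {AP : Type u} {φ : Formula AP} {ν : φ.Valuation}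
    (hν : φ.Consistent ν) {o : AP → Obs}
    (hatom : ∀ (q : AP) (h : Formula.atom q ∈ φ.sub), ν ⟨.atom q, h⟩ = o q) {p : AP}
    (hp : o p = Obs.Z ∨ o p = Obs.E) (hother : ∀ q, q ≠ p → o q = Obs.A ∨ o q = Obs.N)
    (ψ : Formula AP) (hψ : ψ ∈ φ.sub) :
    (ν ⟨ψ, hψ⟩ = o p → ψ.Occurs true p) ∧ (ν ⟨ψ, hψ⟩ = (o p).cNeg → ψ.Occurs false p) := by
  have hn : (o p).cNeg = Obs.Z ∨ (o p).cNeg = Obs.E := by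
    rcases hp with h | h <;> simp [h, Obs.cNeg]
  induction ψ with
  | top =>
    rw [hν.top hψ]
    rcases hp with h | h <;> simp [h, Obs.cNeg]
  | atom q =>
    rw [hatom q hψ]
    by_cases hq : q = p
    · subst hq
      rcases hp with h | h <;> simp [h, Obs.cNeg, Occurs]
    · rcases hp with h | h <;> rcases hother q hq with h' | h' <;> simp [h, h', Obs.cNeg]
  | neg a ih =>
    have ha := mem_sub_of_neg hψ
    rw [hν.neg a ha hψ]
    refine ⟨fun h => (ih ha).2 ?_, fun h => (ih ha).1 ?_⟩
    · rw [← h, Obs.cNeg_cNeg]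
    · rw [← Obs.cNeg_cNeg (ν ⟨a, ha⟩), h, Obs.cNeg_cNeg]
  | and a b iha ihb =>
    obtain ⟨ha, hb⟩ := mem_sub_of_and hψ
    have hx := hν.and a b ha hb hψ
    exact ⟨fun h => (Obs.eq_or_eq_of_mem_cAnd hp hx h).imp (iha ha).1 (ihb hb).1,
      fun h => (Obs.eq_or_eq_of_mem_cAnd hn hx h).imp (iha ha).2 (ihb hb).2⟩
  | or a b iha ihb =>
    obtain ⟨ha, hb⟩ := mem_sub_of_or hψ
    have hx := hν.or a b ha hb hψ
    exact ⟨fun h => (Obs.eq_or_eq_of_mem_cOr hp hx h).imp (iha ha).1 (ihb hb).1,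
      fun h => (Obs.eq_or_eq_of_mem_cOr hn hx h).imp (iha ha).2 (ihb hb).2⟩
  | untl a b iha ihb =>
    obtain ⟨ha, hb⟩ := mem_sub_of_untl hψ
    have hx := hν.untl a b ha hb hψ
    exact ⟨fun h => (Obs.eq_or_eq_of_mem_cUntil hp hx h).imp (iha ha).1 (ihb hb).1,
      fun h => (Obs.eq_or_eq_of_mem_cUntil hn hx h).imp (iha ha).2 (ihb hb).2⟩
  | release a b iha ihb =>
    obtain ⟨ha, hb⟩ := mem_sub_of_release hψ
    have hx := hν.release a b ha hb hψ
    exact ⟨fun h => (Obs.eq_or_eq_of_mem_cRelease hp hx h).imp (iha ha).1 (ihb hb).1,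
      fun h => (Obs.eq_or_eq_of_mem_cRelease hn hx h).imp (iha ha).2 (ihb hb).2⟩

/-! ### Cuts of an interval -/

/-- `J` cuts the interval `[l, r]` into an initial segment containing `l` and a final segment
containing `r`; whether the supremum of the initial segment belongs to it is left open. -/
structure IsCut (l r : ℝ≥0) (J : Set ℝ≥0) : Prop where
  left_mem : l ∈ J
  right_notMem : r ∉ J
  down : ∀ s t, l ≤ s → s ≤ t → t ≤ r → t ∈ J → s ∈ J

/-- The final segment of the cut `J` of `[l, r]` has a first point (expressed through the points
of the initial segment). -/
def RightOpen (l r : ℝ≥0) (J : Set ℝ≥0) : Prop :=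
  ∀ t ∈ J, l ≤ t → t ≤ r → ∃ m, t ≤ m ∧ m ≤ r ∧ m ∉ J ∧ ∀ s, t ≤ s → s < m → s ∈ J

/-- The truth value at `t` of a formula with observation `o`, all changes being described by the
initial segment `J`. -/
def Obs.HoldsOn (J : Set ℝ≥0) : Obs → ℝ≥0 → Prop
  | .A, _ => True
  | .Z, t => t ∈ J
  | .E, t => t ∉ J
  | .N, _ => False

namespace Obs

theorem holdsOn_left {l r : ℝ≥0} {J : Set ℝ≥0} (hJ : IsCut l r J) (o : Obs) :
    o.HoldsOn J l ↔ o = A ∨ o = Z := by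
  cases o <;> simp [HoldsOn, hJ.left_mem]

theorem holdsOn_right {l r : ℝ≥0} {J : Set ℝ≥0} (hJ : IsCut l r J) (o : Obs) :
    o.HoldsOn J r ↔ o = A ∨ o = E := by
  cases o <;> simp [HoldsOn, hJ.right_notMem]

theorem holdsOn_cNeg (J : Set ℝ≥0) (o : Obs) (t : ℝ≥0) :
    o.cNeg.HoldsOn J t ↔ ¬ o.HoldsOn J t := by
  cases o <;> simp [HoldsOn, cNeg]

theorem holdsOn_of_mem_cAnd (J : Set ℝ≥0) {o o₁ o₂ : Obs} (h : o ∈ cAnd o₁ o₂) (t : ℝ≥0) :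
    o.HoldsOn J t ↔ o₁.HoldsOn J t ∧ o₂.HoldsOn J t := by
  cases o₁ <;> cases o₂ <;> simp_all [HoldsOn, cAnd]

theorem holdsOn_of_mem_cOr (J : Set ℝ≥0) {o o₁ o₂ : Obs} (h : o ∈ cOr o₁ o₂) (t : ℝ≥0) :
    o.HoldsOn J t ↔ o₁.HoldsOn J t ∨ o₂.HoldsOn J t := by
  cases o₁ <;> cases o₂ <;> simp_all [HoldsOn, cOr] <;> tauto

end Obs

theorem Separated.exists_hasObs {AP : Type u} {ς : ℝ≥0 → Set AP} {τ : ℝ≥0} (hς : Separated ς τ)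
    (k : ℕ) (p : AP) : ∃ o, HasObs ς τ k p o := by
  have hr : ((k : ℝ≥0) + 1) * τ = k * τ + τ := by ring
  have hle : (k : ℝ≥0) * τ ≤ k * τ + τ := le_self_add
  by_cases hend : p ∈ ς (k * τ) ↔ p ∈ ς (k * τ + τ)
  · have hconst : ∀ t ∈ Icc ((k : ℝ≥0) * τ) ((k + 1) * τ), (p ∈ ς (k * τ) ↔ p ∈ ς t) := by
      rintro t ⟨ht, ht'⟩
      obtain ⟨d, rfl⟩ := exists_add_of_le ht
      rw [hr] at ht'
      exact hς.no_return p _ τ le_rfl hend d (le_of_add_le_add_left ht')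
    by_cases hp : p ∈ ς (k * τ)
    · exact ⟨.A, fun t ht => (hconst t ht).1 hp⟩
    · exact ⟨.N, fun t ht h => hp ((hconst t ht).2 h)⟩
  · -- The instant of the change is the supremum of the times with the old value.
    set T : Set ℝ≥0 := {t | k * τ ≤ t ∧ t ≤ k * τ + τ ∧ (p ∈ ς (k * τ) ↔ p ∈ ς t)} with hT
    have hTl : (k : ℝ≥0) * τ ∈ T := ⟨le_rfl, hle, Iff.rfl⟩
    have hTb : BddAbove T := ⟨_, fun t ht => ht.2.1⟩
    have hdown : ∀ s t, (k : ℝ≥0) * τ ≤ s → s ≤ t → t ∈ T → s ∈ T := by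
      rintro s t hs hst ⟨ht, ht', he⟩
      obtain ⟨d, rfl⟩ := exists_add_of_le hs
      obtain ⟨e, rfl⟩ := exists_add_of_le ht
      exact ⟨hs, hst.trans ht', hς.no_return p _ e (le_of_add_le_add_left ht') he d
        (le_of_add_le_add_left hst)⟩
    have hsup : ∀ t ∈ Icc ((k : ℝ≥0) * τ) ((k + 1) * τ),
        (t < sSup T → (p ∈ ς (k * τ) ↔ p ∈ ς t)) ∧
        (sSup T < t → ¬ (p ∈ ς (k * τ) ↔ p ∈ ς t)) := by
      rintro t ⟨ht, ht'⟩
      refine ⟨fun h => ?_, fun h he => ?_⟩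
      · obtain ⟨s, hs, hts⟩ := exists_lt_of_lt_csSup ⟨_, hTl⟩ h
        exact (hdown t s ht hts.le hs).2.2
      · exact absurd (le_csSup hTb ⟨ht, hr ▸ ht', he⟩) (not_le.2 h)
    have hmem : sSup T ∈ Icc ((k : ℝ≥0) * τ) ((k + 1) * τ) :=
      ⟨le_csSup hTb hTl, hr ▸ csSup_le ⟨_, hTl⟩ fun t ht => ht.2.1⟩
    by_cases hp : p ∈ ς (k * τ)
    · refine ⟨.Z, hp, ?_, sSup T, hmem, fun t ht =>
        ⟨fun h => ((hsup t ht).1 h).1 hp, fun h h' => ?_⟩⟩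
      · rw [hr]
        tauto
      · have := (hsup t ht).2 h
        tauto
    · refine ⟨.E, hp, ?_, sSup T, hmem, fun t ht => ⟨fun h h' => hp (((hsup t ht).1 h).2 h'),
        fun h => ?_⟩⟩
      · rw [hr]
        tauto
      · have := (hsup t ht).2 h
        tauto

/-- The truth values of all propositions on the `k`-th interval are described by a single cut. If it
is not known to be right-open, then it comes from the one proposition that changes. -/
theorem Separated.exists_isCut {AP : Type u} {ς : ℝ≥0 → Set AP} {τ : ℝ≥0} (hτ : 0 < τ)
    (hς : Separated ς τ) (k : ℕ) {o : AP → Obs} (ho : ∀ p, HasObs ς τ k p (o p)) :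
    ∃ J, IsCut (k * τ) ((k + 1) * τ) J ∧
      (∀ p, ∀ t ∈ Icc ((k : ℝ≥0) * τ) ((k + 1) * τ), p ∈ ς t ↔ (o p).HoldsOn J t) ∧
      (RightOpen (k * τ) ((k + 1) * τ) J ∨
        ∃ p, (o p = Obs.Z ∨ o p = Obs.E) ∧ (∀ q, q ≠ p → o q = Obs.A ∨ o q = Obs.N) ∧
          ((∀ t, RightContinuousAt ς p t) → RightOpen (k * τ) ((k + 1) * τ) J)) := by
  have hr : ((k : ℝ≥0) + 1) * τ = k * τ + τ := by ring
  have hlt : (k : ℝ≥0) * τ < (k + 1) * τ := hr ▸ lt_add_of_pos_right _ hτ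
  have hconst : ∀ (J : Set ℝ≥0) p, o p = Obs.A ∨ o p = Obs.N →
      ∀ t ∈ Icc ((k : ℝ≥0) * τ) ((k + 1) * τ), p ∈ ς t ↔ (o p).HoldsOn J t := by
    intro J p hp t ht
    have := ho p
    rcases hp with h | h <;> rw [h] at this ⊢
    · exact iff_of_true (this t ht) trivial
    · exact iff_of_false (this t ht) id
  have hchange : ∀ p, o p = Obs.Z ∨ o p = Obs.E →
      ¬ (p ∈ ς (k * τ) ↔ p ∈ ς (k * τ + τ)) := by
    intro p hp
    have := ho p
    rw [← hr]
    rcases hp with h | h <;> rw [h] at this <;> have h1 := this.1 <;> have h2 := this.2.1 <;> tauto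
  by_cases hex : ∃ p, o p = Obs.Z ∨ o p = Obs.E
  · obtain ⟨p, hp⟩ := hex
    have hother : ∀ q, q ≠ p → o q = Obs.A ∨ o q = Obs.N := by
      intro q hq
      have : ¬ (o q = Obs.Z ∨ o q = Obs.E) := fun h =>
        hq (hς.one_change q p _ (hchange q h) (hchange p hp))
      cases h : o q <;> simp_all
    have hp' := hchange p hp
    rw [← hr] at hp'
    have hcut : IsCut (k * τ) ((k + 1) * τ) {t | p ∈ ς (k * τ) ↔ p ∈ ς t} := by
      refine ⟨Iff.rfl, hp', fun s t hs hst ht he => ?_⟩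
      obtain ⟨d, rfl⟩ := exists_add_of_le hs
      obtain ⟨e, rfl⟩ := exists_add_of_le (hs.trans hst)
      rw [hr] at ht
      exact hς.no_return p _ e (le_of_add_le_add_left ht) he d (le_of_add_le_add_left hst)
    refine ⟨{t | p ∈ ς (k * τ) ↔ p ∈ ς t}, hcut, ?_, Or.inr ⟨p, hp, hother, fun hcont => ?_⟩⟩
    · intro q t ht
      by_cases hq : q = p
      · subst hq
        have := ho q
        rcases hp with h | h <;> rw [h] at this ⊢ <;> have h1 := this.1 <;>
          simp [Obs.HoldsOn, h1]
      · exact hconst _ q (hother q hq) t ht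
    · -- The final segment contains its infimum, by right-continuity there.
      intro t htJ hlt' htr
      set T : Set ℝ≥0 := {s | t ≤ s ∧ s ≤ (k + 1) * τ ∧ ¬ (p ∈ ς (k * τ) ↔ p ∈ ς s)} with hT
      have hTr : ((k : ℝ≥0) + 1) * τ ∈ T := ⟨htr, le_rfl, hp'⟩
      have hTb : BddBelow T := OrderBot.bddBelow T
      have hle : sInf T ≤ (k + 1) * τ := csInf_le hTb hTr
      have hge : t ≤ sInf T := le_csInf ⟨_, hTr⟩ fun s hs => hs.1
      refine ⟨sInf T, hge, hle, fun hm => ?_, fun s hts hs => ?_⟩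
      · have hne : sInf T < (k + 1) * τ := lt_of_le_of_ne hle fun h => hp' (h ▸ hm)
        obtain ⟨e, he, hes⟩ := (mem_nhdsGT_iff_exists_Ioo_subset' hne).1 (hcont (sInf T))
        obtain ⟨s, hs, hse⟩ := exists_lt_of_csInf_lt ⟨_, hTr⟩ he
        rcases (csInf_le hTb hs).eq_or_lt with h | h
        · exact hs.2.2 (h ▸ hm)
        · have h1 : p ∈ ς s ↔ p ∈ ς (sInf T) := hes ⟨h, hse⟩
          exact hs.2.2 (Iff.trans hm h1.symm)
      · by_contra hsJ
        exact absurd (csInf_le hTb ⟨hts, hs.le.trans hle, hsJ⟩) (not_le.2 hs)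
  · have hall : ∀ p, o p = Obs.A ∨ o p = Obs.N := fun p => by
      have := fun h => hex ⟨p, h⟩
      cases h : o p <;> simp_all
    refine ⟨Iio ((k + 1) * τ), ⟨hlt, fun h => lt_irrefl _ (mem_Iio.1 h),
        fun s t _ hst _ ht => lt_of_le_of_lt hst ht⟩,
      fun p => hconst _ p (hall p), Or.inl fun t _ _ htr => ?_⟩
    exact ⟨_, htr, le_rfl, fun h => lt_irrefl _ (mem_Iio.1 h), fun s _ hs => hs⟩

/-! ### Until -/

/-- The until operator on predicates of time. -/
def Until (a b : ℝ≥0 → Prop) (t : ℝ≥0) : Prop :=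
  ∃ t', t ≤ t' ∧ b t' ∧ ∀ t'', t ≤ t'' → t'' < t' → a t''

namespace Until

variable {a b : ℝ≥0 → Prop} {s t : ℝ≥0}

theorem of_right (h : b t) : Until a b t :=
  ⟨t, le_rfl, h, fun _ h1 h2 => absurd h2 (not_lt.2 h1)⟩

theorem of_later (hts : t ≤ s) (ha : ∀ x, t ≤ x → x < s → a x) (h : Until a b s) :
    Until a b t := by
  obtain ⟨t', hst', hb, ha'⟩ := h
  refine ⟨t', hts.trans hst', hb, fun x hx hx' => ?_⟩
  rcases lt_or_ge x s with h | h
  · exact ha x hx h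
  · exact ha' x h hx'

theorem left_or_right (h : Until a b t) : a t ∨ b t := by
  obtain ⟨t', ht', hb, ha⟩ := h
  rcases ht'.eq_or_lt with rfl | h
  · exact Or.inr hb
  · exact Or.inl (ha t le_rfl h)

theorem later (h : Until a b t) (hts : t ≤ s) (hb : ∀ x, t ≤ x → x < s → ¬ b x) :
    Until a b s := by
  obtain ⟨t', ht', hbt', ha⟩ := h
  have hst' : s ≤ t' := not_lt.1 fun h => hb t' ht' h hbt'
  exact ⟨t', hst', hbt', fun x hx hx' => ha x (hts.trans hx) hx'⟩

end Until

/-- The until table is correct on one interval: if the arguments have observations `o₁` and `o₂`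
with respect to the cut `J`, then the until formula has one of the observations in the table. -/
theorem exists_cUntil_holdsOn {l r : ℝ≥0} (hlr : l ≤ r) {J : Set ℝ≥0} (hJ : IsCut l r J)
    {a b : ℝ≥0 → Prop} {o₁ o₂ : Obs} (ha : ∀ t ∈ Icc l r, a t ↔ o₁.HoldsOn J t)
    (hb : ∀ t ∈ Icc l r, b t ↔ o₂.HoldsOn J t)
    (hopen : o₁ = Obs.Z → o₂ = Obs.E → RightOpen l r J) :
    ∃ o ∈ Obs.cUntil o₁ o₂, ∀ t ∈ Icc l r, Until a b t ↔ o.HoldsOn J t := by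
  have hrI : r ∈ Icc l r := ⟨hlr, le_rfl⟩
  have hrJ := hJ.right_notMem
  have up : ∀ t ∈ Icc l r, t ∉ J → ∀ x, t ≤ x → x ≤ r → x ∉ J := fun t ht htJ x hx hxr h =>
    htJ (hJ.down t x ht.1 hx hxr h)
  have hright : ∀ t ∈ Icc l r, o₂.HoldsOn J t → Until a b t := fun t ht h =>
    .of_right ((hb t ht).2 h)
  have hnot : ∀ t ∈ Icc l r, ¬ o₁.HoldsOn J t → ¬ o₂.HoldsOn J t → ¬ Until a b t :=
    fun t ht h1 h2 h => h.left_or_right.elim (fun h => h1 ((ha t ht).1 h))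
      fun h => h2 ((hb t ht).1 h)
  have hback : ∀ t ∈ Icc l r, ∀ s, t ≤ s → s ≤ r → (∀ x, t ≤ x → x < s → o₁.HoldsOn J x) →
      Until a b s → Until a b t := fun t ht s hts hsr h =>
    .of_later hts fun x hx hxs => (ha x ⟨ht.1.trans hx, hxs.le.trans hsr⟩).2 (h x hx hxs)
  have hforth : ∀ t ∈ Icc l r, (∀ x, t ≤ x → x < r → ¬ o₂.HoldsOn J x) →
      Until a b t → Until a b r := fun t ht h hU =>
    hU.later ht.2 fun x hx hxr hbx => h x hx hxr ((hb x ⟨ht.1.trans hx, hxr.le⟩).1 hbx)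
  cases o₂ with
  | A => exact ⟨.A, by cases o₁ <;> simp [Obs.cUntil],
      fun t ht => iff_of_true (hright t ht trivial) trivial⟩
  | Z =>
    have hZ : (∀ t ∈ Icc l r, t ∉ J → ¬ Until a b t) →
        ∀ t ∈ Icc l r, Until a b t ↔ Obs.Z.HoldsOn J t := fun h t ht =>
      ⟨fun hU => by_contra fun htJ => h t ht htJ hU, hright t ht⟩
    have hend : ¬ Until a b r → ∀ t ∈ Icc l r, t ∉ J → ¬ Until a b t := fun hU t ht htJ h =>
      hU (hforth t ht (fun x hx hxr => up t ht htJ x hx hxr.le) h)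
    cases o₁ with
    | A =>
      by_cases hU : Until a b r
      · exact ⟨.A, by simp [Obs.cUntil], fun t ht =>
          iff_of_true (hback t ht r ht.2 le_rfl (fun _ _ _ => trivial) hU) trivial⟩
      · exact ⟨.Z, by simp [Obs.cUntil], hZ (hend hU)⟩
    | Z => exact ⟨.Z, by simp [Obs.cUntil], hZ fun t ht htJ => hnot t ht htJ htJ⟩
    | E =>
      by_cases hU : Until a b r
      · refine ⟨.A, by simp [Obs.cUntil], fun t ht => iff_of_true ?_ trivial⟩
        by_cases htJ : t ∈ J
        · exact hright t ht htJ
        · exact hback t ht r ht.2 le_rfl (fun x hx hxr => up t ht htJ x hx hxr.le) hU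
      · exact ⟨.Z, by simp [Obs.cUntil], hZ (hend hU)⟩
    | N => exact ⟨.Z, by simp [Obs.cUntil], hZ fun t ht htJ => hnot t ht id htJ⟩
  | E =>
    have hUr : Until a b r := hright r hrI hrJ
    have hE : (∀ t ∈ Icc l r, t ∈ J → ¬ Until a b t) →
        ∀ t ∈ Icc l r, Until a b t ↔ Obs.E.HoldsOn J t := fun h t ht =>
      ⟨fun hU htJ => h t ht htJ hU, hright t ht⟩
    cases o₁ with
    | A => exact ⟨.A, by simp [Obs.cUntil], fun t ht =>
        iff_of_true (hback t ht r ht.2 le_rfl (fun _ _ _ => trivial) hUr) trivial⟩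
    | Z =>
      refine ⟨.A, by simp [Obs.cUntil], fun t ht => iff_of_true ?_ trivial⟩
      by_cases htJ : t ∈ J
      · obtain ⟨m, htm, hmr, hm, hlt⟩ := hopen rfl rfl t htJ ht.1 ht.2
        exact hback t ht m htm hmr hlt (hright m ⟨ht.1.trans htm, hmr⟩ hm)
      · exact hright t ht htJ
    | E => exact ⟨.E, by simp [Obs.cUntil], hE fun t ht htJ =>
        hnot t ht (fun h => h htJ) (fun h => h htJ)⟩
    | N => exact ⟨.E, by simp [Obs.cUntil], hE fun t ht htJ => hnot t ht id (fun h => h htJ)⟩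
  | N =>
    have hN : ¬ Until a b r → ∀ t ∈ Icc l r, Until a b t ↔ Obs.N.HoldsOn J t := fun hU t ht =>
      iff_of_false (fun h => hU (hforth t ht (fun _ _ _ => id) h)) id
    cases o₁ with
    | A =>
      by_cases hU : Until a b r
      · exact ⟨.A, by simp [Obs.cUntil], fun t ht =>
          iff_of_true (hback t ht r ht.2 le_rfl (fun _ _ _ => trivial) hU) trivial⟩
      · exact ⟨.N, by simp [Obs.cUntil], hN hU⟩
    | Z => exact ⟨.N, by simp [Obs.cUntil], hN (hnot r hrI hrJ id)⟩
    | E =>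
      by_cases hU : Until a b r
      · refine ⟨.E, by simp [Obs.cUntil], fun t ht => ⟨fun h htJ => ?_, fun htJ => ?_⟩⟩
        · exact hnot t ht (fun h => h htJ) id h
        · exact hback t ht r ht.2 le_rfl (fun x hx hxr => up t ht htJ x hx hxr.le) hU
      · exact ⟨.N, by simp [Obs.cUntil], hN hU⟩
    | N => exact ⟨.N, by simp [Obs.cUntil], hN (hnot r hrI id id)⟩

namespace Obs

theorem eq_of_mem_cUntil {o₁ o₂ x y : Obs} (hx : x ∈ cUntil o₁ o₂) (hy : y ∈ cUntil o₁ o₂)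
    (h : (x = A ∨ x = E) ↔ (y = A ∨ y = E)) : x = y := by
  cases o₁ <;> cases o₂ <;> cases x <;> cases y <;> simp_all [cUntil]

/-- Two elements of an entry of the until table with different left and different right truth values
are `A` and `N`, in the entry `(A, N)`. -/
theorem of_mem_cUntil_of_ne {o₁ o₂ x y : Obs} (hx : x ∈ cUntil o₁ o₂) (hy : y ∈ cUntil o₁ o₂)
    (hne : x ≠ y) (h : ¬ ((x = A ∨ x = Z) ↔ (y = A ∨ y = Z))) :
    o₂ = N ∧ (x = A ∨ y = A) := by
  cases o₁ <;> cases o₂ <;> cases x <;> cases y <;> simp_all [cUntil]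

end Obs

/-- Guessed observations `u k` of an until formula that obey the table, fit together at the sampling
times and satisfy the acceptance condition are the actual ones. -/
theorem until_iff_holdsOn {τ : ℝ≥0} (hτ : 0 < τ) {J : ℕ → Set ℝ≥0}
    (hJ : ∀ k : ℕ, IsCut (k * τ) ((k + 1) * τ) (J k)) {a b : ℝ≥0 → Prop} {o₁ o₂ u : ℕ → Obs}
    (ha : ∀ k : ℕ, ∀ t ∈ Icc (k * τ) ((k + 1) * τ), a t ↔ (o₁ k).HoldsOn (J k) t)
    (hb : ∀ k : ℕ, ∀ t ∈ Icc (k * τ) ((k + 1) * τ), b t ↔ (o₂ k).HoldsOn (J k) t)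
    (hopen : ∀ k : ℕ, o₁ k = Obs.Z → o₂ k = Obs.E → RightOpen (k * τ) ((k + 1) * τ) (J k))
    (hu : ∀ k, u k ∈ Obs.cUntil (o₁ k) (o₂ k))
    (hstep : ∀ k, (u k = Obs.A ∨ u k = Obs.E) ↔ (u (k + 1) = Obs.A ∨ u (k + 1) = Obs.Z))
    (hacc : ∃ᶠ k in atTop, o₂ k ≠ Obs.N ∨ u k ≠ Obs.A) :
    ∀ k : ℕ, ∀ t ∈ Icc (k * τ) ((k + 1) * τ), Until a b t ↔ (u k).HoldsOn (J k) t := by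
  have hle : ∀ k : ℕ, (k : ℝ≥0) * τ ≤ (k + 1) * τ := fun k =>
    mul_le_mul_left (le_add_of_nonneg_right zero_le_one) τ
  choose w hw hwU using fun k : ℕ => exists_cUntil_holdsOn (hle k) (hJ k) (ha k) (hb k) (hopen k)
  have hleft : ∀ k, (w k = Obs.A ∨ w k = Obs.Z) ↔ Until a b (k * τ) := fun k =>
    (Obs.holdsOn_left (hJ k) _).symm.trans (hwU k _ ⟨le_rfl, hle k⟩).symm
  have hright : ∀ k, (w k = Obs.A ∨ w k = Obs.E) ↔ Until a b ((k + 1 : ℕ) * τ) := fun k => by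
    push_cast
    exact (Obs.holdsOn_right (hJ k) _).symm.trans (hwU k _ ⟨hle k, le_rfl⟩).symm
  suffices h : ∀ k, u k = w k by
    intro k
    rw [h k]
    exact hwU k
  intro k
  by_contra hk
  -- A wrong guess is wrong at the right endpoint, hence at the next left endpoint.
  have hprop : ∀ j, u j ≠ w j →
      ¬ ((u (j + 1) = Obs.A ∨ u (j + 1) = Obs.Z) ↔ (w (j + 1) = Obs.A ∨ w (j + 1) = Obs.Z)) := by
    intro j hj h
    rw [← hstep, hleft, ← hright] at h
    exact hj (Obs.eq_of_mem_cUntil (hu j) (hw j) h)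
  have hne : ∀ j, k ≤ j → u j ≠ w j := by
    intro j hj
    induction j, hj using Nat.le_induction with
    | base => exact hk
    | succ j _ ih => exact fun h => hprop j ih (by rw [h])
  have hcase : ∀ j, k + 1 ≤ j → o₂ j = Obs.N ∧ (u j = Obs.A ∨ w j = Obs.A) := by
    intro j hj
    obtain ⟨j, rfl⟩ : ∃ i, j = i + 1 := ⟨j - 1, by omega⟩
    exact Obs.of_mem_cUntil_of_ne (hu _) (hw _) (hne _ (by omega)) (hprop j (hne j (by omega)))
  have hnever : ∀ t, ((k + 1 : ℕ) : ℝ≥0) * τ ≤ t → ¬ b t := by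
    intro t ht hbt
    have h1 : ((⌊t / τ⌋₊ : ℕ) : ℝ≥0) * τ ≤ t := (le_div_iff₀ hτ).1 (Nat.floor_le zero_le)
    have h2 : t ≤ (((⌊t / τ⌋₊ : ℕ) : ℝ≥0) + 1) * τ :=
      (div_le_iff₀ hτ).1 (Nat.lt_floor_add_one _).le
    have h3 : k + 1 ≤ ⌊t / τ⌋₊ := Nat.le_floor ((le_div_iff₀ hτ).2 ht)
    have h4 := (hb _ t ⟨h1, h2⟩).1 hbt
    rw [(hcase _ h3).1] at h4
    exact h4
  obtain ⟨j, hj, hj'⟩ := Filter.frequently_atTop.1 hacc (k + 1)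
  obtain ⟨ho, h | h⟩ := hcase j hj
  · exact hj'.elim (fun h' => h' ho) (fun h' => h' h)
  · obtain ⟨t', ht', hbt', _⟩ := (hleft j).1 (Or.inl h)
    refine hnever t' (le_trans ?_ ht') hbt'
    exact mul_le_mul_left (Nat.cast_le.2 hj) τ

/-! ### Accepting runs describe the signal -/

theorem sat_release {AP : Type u} (ς : ℝ≥0 → Set AP) (a b : Formula AP) (t : ℝ≥0) :
    Sat ς (a.release b) t ↔ ¬ Until (fun t => ¬ Sat ς a t) (fun t => ¬ Sat ς b t) t := Iff.rfl

/-- The valuations of an accepting run on the observations of a signal give, on each sampling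
interval, the observations of all subformulas along that signal. -/
theorem sat_iff_holdsOn {AP : Type u} {ς : ℝ≥0 → Set AP} {τ : ℝ≥0} (hτ : 0 < τ)
    {φ : Formula AP} {ν : ℕ → φ.Valuation} (hν : ∀ k, φ.Consistent (ν k)) {o : ℕ → AP → Obs}
    (hatom : ∀ k (p : AP) (h : Formula.atom p ∈ φ.sub), ν k ⟨.atom p, h⟩ = o k p)
    (hstep : ∀ k ψ, (ν k ψ = Obs.A ∨ ν k ψ = Obs.E) ↔ (ν (k + 1) ψ = Obs.A ∨ ν (k + 1) ψ = Obs.Z))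
    (haccU : ∀ (a b : Formula AP) (hb : b ∈ φ.sub) (h : a.untl b ∈ φ.sub),
      ∃ᶠ k in atTop, ν k ⟨b, hb⟩ ≠ Obs.N ∨ ν k ⟨a.untl b, h⟩ ≠ Obs.A)
    (haccR : ∀ (a b : Formula AP) (hb : b ∈ φ.sub) (h : a.release b ∈ φ.sub),
      ∃ᶠ k in atTop, ν k ⟨b, hb⟩ ≠ Obs.A ∨ ν k ⟨a.release b, h⟩ ≠ Obs.N)
    {J : ℕ → Set ℝ≥0} (hJ : ∀ k : ℕ, IsCut (k * τ) ((k + 1) * τ) (J k))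
    (ho : ∀ (k : ℕ) p, ∀ t ∈ Icc (k * τ) ((k + 1) * τ), p ∈ ς t ↔ (o k p).HoldsOn (J k) t)
    (hopen : ∀ k : ℕ, RightOpen (k * τ) ((k + 1) * τ) (J k) ∨
      ∃ p, (o k p = Obs.Z ∨ o k p = Obs.E) ∧ (∀ q, q ≠ p → o k q = Obs.A ∨ o k q = Obs.N) ∧
        ((∀ t, RightContinuousAt ς p t) → RightOpen (k * τ) ((k + 1) * τ) (J k)))
    (hφ : ∀ p, φ.Occurs true p → φ.Occurs false p → ∀ t, RightContinuousAt ς p t)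
    (ψ : Formula AP) (hψ : ψ ∈ φ.sub) :
    ∀ k : ℕ, ∀ t ∈ Icc (k * τ) ((k + 1) * τ), Sat ς ψ t ↔ (ν k ⟨ψ, hψ⟩).HoldsOn (J k) t := by
  -- Changes in opposite directions below one subformula force the changing proposition to occur
  -- with both polarities.
  have hmixed : ∀ (k : ℕ) (a b ψ : Formula AP) (ha : a ∈ φ.sub) (hb : b ∈ φ.sub), ψ ∈ φ.sub →
      (∀ s p, a.Occurs s p ∨ b.Occurs s p → ψ.Occurs s p) →
      ν k ⟨a, ha⟩ = Obs.Z ∨ ν k ⟨a, ha⟩ = Obs.E → ν k ⟨b, hb⟩ = (ν k ⟨a, ha⟩).cNeg →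
      RightOpen (k * τ) ((k + 1) * τ) (J k) := by
    intro k a b ψ ha hb hψ hocc hνa hνb
    rcases hopen k with h | ⟨p, hp, hother, hcont⟩
    · exact h
    · have hboth : ∀ s, ψ.Occurs s p := by
        have h1 := (hν k).occurs (hatom k) hp hother a ha
        have h2 := (hν k).occurs (hatom k) hp hother b hb
        rw [hνb] at h2
        have : (ν k ⟨a, ha⟩ = o k p) ∨ ν k ⟨a, ha⟩ = (o k p).cNeg := by
          rcases hp with h | h <;> rcases hνa with h' | h' <;> simp [h, h', Obs.cNeg]
        rcases this with h | h
        · rintro (_ | _)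
          · exact hocc _ _ (Or.inr (h2.2 (by rw [h])))
          · exact hocc _ _ (Or.inl (h1.1 h))
        · rintro (_ | _)
          · exact hocc _ _ (Or.inl (h1.2 h))
          · exact hocc _ _ (Or.inr (h2.1 (by rw [h, Obs.cNeg_cNeg])))
      have := Formula.occurs_both_of_mem_sub hψ hboth
      exact hcont (hφ p (this true) (this false))
  induction ψ with
  | top =>
    intro k t _
    rw [(hν k).top hψ]
    exact Iff.rfl
  | atom p =>
    intro k t ht
    rw [hatom k p hψ]
    exact ho k p t ht
  | neg a ih =>
    intro k t ht
    have ha := Formula.mem_sub_of_neg hψ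
    rw [(hν k).neg a ha hψ, Obs.holdsOn_cNeg]
    exact not_congr (ih ha k t ht)
  | and a b iha ihb =>
    intro k t ht
    obtain ⟨ha, hb⟩ := Formula.mem_sub_of_and hψ
    rw [Obs.holdsOn_of_mem_cAnd _ ((hν k).and a b ha hb hψ)]
    exact and_congr (iha ha k t ht) (ihb hb k t ht)
  | or a b iha ihb =>
    intro k t ht
    obtain ⟨ha, hb⟩ := Formula.mem_sub_of_or hψ
    rw [Obs.holdsOn_of_mem_cOr _ ((hν k).or a b ha hb hψ)]
    exact or_congr (iha ha k t ht) (ihb hb k t ht)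
  | untl a b iha ihb =>
    obtain ⟨ha, hb⟩ := Formula.mem_sub_of_untl hψ
    exact until_iff_holdsOn hτ hJ (iha ha) (ihb hb)
      (fun k h1 h2 => hmixed k a b _ ha hb hψ (fun _ _ => id) (Or.inl h1) (by rw [h1, h2]; rfl))
      (fun k => (hν k).untl a b ha hb hψ) (fun k => hstep k _) (haccU a b hb hψ)
  | release a b iha ihb =>
    obtain ⟨ha, hb⟩ := Formula.mem_sub_of_release hψ
    have hcNeg : ∀ x y : Obs, x.cNeg = y ↔ x = y.cNeg := fun x y => by
      cases x <;> cases y <;> simp [Obs.cNeg]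
    have h := until_iff_holdsOn hτ hJ (o₁ := fun k => (ν k ⟨a, ha⟩).cNeg)
      (o₂ := fun k => (ν k ⟨b, hb⟩).cNeg) (u := fun k => (ν k ⟨a.release b, hψ⟩).cNeg)
      (fun k t ht => (not_congr (iha ha k t ht)).trans (Obs.holdsOn_cNeg _ _ _).symm)
      (fun k t ht => (not_congr (ihb hb k t ht)).trans (Obs.holdsOn_cNeg _ _ _).symm)
      (fun k h1 h2 => by
        rw [hcNeg] at h1 h2
        exact hmixed k a b _ ha hb hψ (fun _ _ => id) (Or.inr h1) (by rw [h1, h2]; rfl))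
      (fun k => (Obs.cRelease_eq_cUntil _ _ _).1 ((hν k).release a b ha hb hψ))
      (fun k => by
        have := hstep k ⟨a.release b, hψ⟩
        revert this
        cases ν k ⟨a.release b, hψ⟩ <;> cases ν (k + 1) ⟨a.release b, hψ⟩ <;> simp [Obs.cNeg])
      ((haccR a b hb hψ).mono fun k => by
        simp only [ne_eq, hcNeg]
        exact id)
    intro k t ht
    rw [sat_release, h k t ht, Obs.holdsOn_cNeg, not_not]

/-! ### The run that Player produces along a trajectory -/

/-- A winning strategy of Player turns every path of the symbolic model into an accepting run of the
automaton on the labels of this path. -/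
theorem exists_accepting_run {AP : Type u} {Q : Type v} {B : Type w} {S : SymbolicModel AP Q}
    {M : ObsAutomaton AP B} (hwin : (productGame S M).Winning) {q : ℕ → Q} {o : ℕ → AP → Obs}
    (hq₀ : q 0 = S.start) (hq : ∀ k, (q k, o k, q (k + 1)) ∈ S.trans) :
    ∃ b : ℕ → B, b 0 = M.start ∧ (∀ k, (b k, o k, b (k + 1)) ∈ M.trans) ∧
      ∃ᶠ k in atTop, b k ∈ M.final := by
  obtain ⟨π₀, hπ₀, hwon⟩ := hwin
  set G := productGame S M with hG
  have hinr : ∀ x, (Sum.inr x : (Q × B) ⊕ (Q × (AP → Obs) × B)) ∈ G.player := fun x => ⟨x, rfl⟩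
  have hinl : ∀ x, (Sum.inl x : (Q × B) ⊕ (Q × (AP → Obs) × B)) ∉ G.player := by
    rintro x ⟨y, hy⟩
    cases hy
  have hnotStuck : ∀ x, Relation.ReflTransGen (G.Follows π₀) G.start (.inr x) →
      ¬ G.Stuck (.inr x) := fun x hx hst =>
    BuchiGame.not_reflTransGen_trap hwon (C := {.inr x})
      (fun g hg hs => absurd hst (by rwa [← mem_singleton_iff.1 hg]))
      (fun g hg hp => absurd (hinr x) (by rwa [← mem_singleton_iff.1 hg]))
      (fun g hg _ hs => absurd hst (by rwa [← mem_singleton_iff.1 hg])) rfl hx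
  let b : ℕ → B := fun k => k.rec M.start fun k bk =>
    match π₀ (.inr (q (k + 1), o k, bk)) with
    | .inl (_, b') => b'
    | .inr _ => bk
  have hopp : ∀ k, G.Follows π₀ (.inl (q k, b k)) (.inr (q (k + 1), o k, b k)) := fun k =>
    ⟨fun h => absurd h (hinl _), fun _ => ⟨hq k, rfl⟩⟩
  have hmove : ∀ k, Relation.ReflTransGen (G.Follows π₀) G.start (.inl (q k, b k)) →
      π₀ (.inr (q (k + 1), o k, b k)) = .inl (q (k + 1), b (k + 1)) ∧
        (b k, o k, b (k + 1)) ∈ M.trans := by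
    intro k hk
    have hedge := hπ₀ _ (hinr _) (hnotStuck _ (hk.tail (hopp k)))
    have hb : b (k + 1) = match π₀ (.inr (q (k + 1), o k, b k)) with
      | .inl (_, b') => b'
      | .inr _ => b k := rfl
    rcases hπ : π₀ (.inr (q (k + 1), o k, b k)) with ⟨q', b'⟩ | x
    · rw [hπ] at hedge hb
      obtain ⟨ht, hq'⟩ := hedge
      rw [hb, hq']
      exact ⟨rfl, ht⟩
    · rw [hπ] at hedge
      exact hedge.elim
  have hreach : ∀ k, Relation.ReflTransGen (G.Follows π₀) G.start (.inl (q k, b k)) := by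
    intro k
    induction k with
    | zero => rw [hq₀]; exact .refl
    | succ k ih =>
      refine (ih.tail (hopp k)).tail ⟨fun _ => (hmove k ih).1.symm, fun h => absurd (hinr _) h⟩
  refine ⟨b, rfl, fun k => (hmove k (hreach k)).2, ?_⟩
  by_contra hfin
  obtain ⟨N, hN⟩ := Filter.eventually_atTop.1 (Filter.not_frequently.1 hfin)
  refine BuchiGame.not_reflTransGen_trap hwon (C := {g | ∃ k, N ≤ k ∧
    (g = .inl (q k, b k) ∨ g = .inr (q (k + 1), o k, b k))}) ?_ ?_ ?_ ⟨N, le_rfl, .inl rfl⟩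
    (hreach N)
  · rintro g ⟨k, hk, rfl | rfl⟩ _ ⟨q', b', hb', h⟩
    · simp only [Sum.inl.injEq, Prod.mk.injEq] at h
      exact hN k hk (h.2 ▸ hb')
    · cases h
  · rintro g ⟨k, hk, rfl | rfl⟩ hp
    · exact ⟨_, ⟨k, hk, .inr rfl⟩, (hopp k).2 hp⟩
    · exact absurd (hinr _) hp
  · rintro g ⟨k, hk, rfl | rfl⟩ hp _
    · exact absurd hp (hinl _)
    · exact ⟨k + 1, by omega, .inl (hmove k (hreach k)).1⟩

/-- The observations along a trajectory label a path of a symbolic model that represents the system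
soundly. -/
theorem Represents.mem_trans {n : ℕ} {AP : Type u} {Q : Type v} {D : DynSystem n}
    {P : D.X → Set AP} {τ : ℝ≥0} {S : SymbolicModel AP Q} {γ : D.X → Q}
    {ρZ ρE : Q → Q → AP → Approx} (hS : Represents D P τ S γ ρZ ρE) {σ : ℝ≥0 → D.X}
    (hσ : D.IsTrajectory σ) (k : ℕ) {o : AP → Obs}
    (ho : ∀ p, HasObs (fun t => P (σ t)) τ k p (o p)) :
    (γ (σ (k * τ)), o, γ (σ ((k + 1 : ℕ) * τ))) ∈ S.trans := by
  have hr : ((k + 1 : ℕ) : ℝ≥0) * τ = k * τ + τ := by push_cast; ring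
  have hr' : ((k : ℝ≥0) + 1) * τ = k * τ + τ := by ring
  refine hS.trans_complete _ _ ⟨_, _, hr ▸ hσ (k * τ) τ, rfl, rfl⟩ o fun p => ?_
  have hfin : D.IsFiniteTrajectory τ (fun t => σ (k * τ + t)) := fun s t _ => by
    simp only [← add_assoc]
    exact hσ _ _
  have := hS.obs_sound _ hfin p (o p) ?_
  · rw [hr]
    simpa using this
  · have hp := ho p
    have hI : ∀ t ∈ Icc (0 : ℝ≥0) τ, k * τ + t ∈ Icc ((k : ℝ≥0) * τ) ((k + 1) * τ) := fun t ht =>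
      ⟨le_self_add, by rw [hr']; exact add_le_add_right ht.2 _⟩
    -- For `Z` and `E` the instant of the change is shifted by `kτ` as well.
    cases h : o p <;> rw [h] at hp <;> simp only [HasObs, hr'] at hp <;>
      simp only [HasObs, Nat.cast_zero, zero_mul, zero_add, one_mul, add_zero]
    · exact fun t ht => hp _ (hr' ▸ hI t ht)
    · obtain ⟨h0, h1, t', ht', H⟩ := hp
      obtain ⟨d, rfl⟩ := exists_add_of_le ht'.1
      exact ⟨h0, h1, d, ⟨zero_le, le_of_add_le_add_left ht'.2⟩, fun t ht =>
        ⟨fun h => (H _ (hr' ▸ hI t ht)).1 (add_lt_add_right h _),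
          fun h => (H _ (hr' ▸ hI t ht)).2 (add_lt_add_right h _)⟩⟩
    · obtain ⟨h0, h1, t', ht', H⟩ := hp
      obtain ⟨d, rfl⟩ := exists_add_of_le ht'.1
      exact ⟨h0, h1, d, ⟨zero_le, le_of_add_le_add_left ht'.2⟩, fun t ht =>
        ⟨fun h => (H _ (hr' ▸ hI t ht)).1 (add_lt_add_right h _),
          fun h => (H _ (hr' ▸ hI t ht)).2 (add_lt_add_right h _)⟩⟩
    · exact fun t ht => hp _ (hr' ▸ hI t ht)

end APObs

theorem mainTheorem1 {n : ℕ} {AP : Type*} [Finite AP] {Q : Type*}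
    (D : APObs.DynSystem n) (P : D.X → Set AP) (τ : ℝ≥0) (hτ : 0 < τ)
    (hsep : ∀ σ ∈ D.Traj, APObs.Separated (fun t => P (σ t)) τ)
    (S : APObs.SymbolicModel AP Q) (γ : D.X → Q) (ρZ ρE : Q → Q → AP → APObs.Approx)
    (hS : APObs.Represents D P τ S γ ρZ ρE)
    (φ : APObs.Formula AP)
    (hφ : ∀ p, φ.Occurs true p → φ.Occurs false p →
      ∀ σ ∈ D.Traj, ∀ t, APObs.RightContinuousAt (fun t => P (σ t)) p t)
    (hwin : (APObs.productGame S φ.automaton).Winning) :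
    ∀ σ ∈ D.Traj, APObs.Sat (fun t => P (σ t)) φ 0 := by
  intro σ hσ
  have hς := hsep σ hσ
  choose o ho using hς.exists_hasObs
  choose J hJ hoJ hopen using fun k => hς.exists_isCut hτ k (ho k)
  obtain ⟨b, hb₀, hb, hfreq⟩ := APObs.exists_accepting_run hwin
    (q := fun k => γ (σ (k * τ))) (o := o) (by simp [hS.start_eq, hσ.2])
    (fun k => hS.mem_trans hσ.1 k (ho k))
  have htrans : ∀ k, φ.genTrans (b k).1 (o k) (b (k + 1)).1 := fun k => (hb k).1
  have hsome : ∀ k, ∃ ν, (b (k + 1)).1 = some ν := by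
    intro k
    have := htrans k
    rcases h : (b (k + 1)).1 with _ | ν
    · rw [h] at this
      cases h' : (b k).1 <;> simp [h', APObs.Formula.genTrans] at this
    · exact ⟨ν, rfl⟩
  choose ν hν using hsome
  have hatom : ∀ k (p : AP) (h : APObs.Formula.atom p ∈ φ.sub),
      (ν k).1 ⟨.atom p, h⟩ = o k p := by
    intro k
    have := htrans k
    rw [hν k] at this
    cases h' : (b k).1 <;> rw [h'] at this <;> exact this.1
  have hstep : ∀ k ψ, ((ν k).1 ψ = .A ∨ (ν k).1 ψ = .E) ↔
      ((ν (k + 1)).1 ψ = .A ∨ (ν (k + 1)).1 ψ = .Z) := by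
    intro k
    have := htrans (k + 1)
    rw [hν k, hν (k + 1)] at this
    exact this.2
  have hinit : (ν 0).1 ⟨φ, φ.self_mem_sub⟩ = .A ∨ (ν 0).1 ⟨φ, φ.self_mem_sub⟩ = .Z := by
    have := htrans 0
    rw [hν 0, hb₀] at this
    exact this.2
  have hacc : ∀ F ∈ φ.accepting, ∃ᶠ k in atTop, some (ν k) ∈ F := by
    intro F hF
    have h := APObs.GenObsAutomaton.frequently_mem_final (M := φ.genAutomaton) hb hfreq hF
    rw [Filter.frequently_atTop] at h ⊢
    intro N
    obtain ⟨i, hi, hiF⟩ := h (N + 1)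
    obtain ⟨i, rfl⟩ : ∃ j, i = j + 1 := ⟨i - 1, by omega⟩
    exact ⟨i, by omega, hν i ▸ hiF⟩
  have hsat := APObs.sat_iff_holdsOn hτ (fun k => (ν k).2) hatom hstep
    (fun a b hb h => by
      refine (hacc _ (List.mem_filterMap.2 ⟨a.untl b, h, rfl⟩)).mono ?_
      rintro k ⟨ν', hk, H⟩
      rw [Option.some.inj hk]
      exact H hb h)
    (fun a b hb h => by
      refine (hacc _ (List.mem_filterMap.2 ⟨a.release b, h, rfl⟩)).mono ?_
      rintro k ⟨ν', hk, H⟩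
      rw [Option.some.inj hk]
      exact H hb h)
    hJ hoJ hopen (fun p h1 h2 => hφ p h1 h2 σ hσ) φ φ.self_mem_sub 0 0 (by simp)
  have h0 := APObs.Obs.holdsOn_left (hJ 0) ((ν 0).1 ⟨φ, φ.self_mem_sub⟩)
  rw [Nat.cast_zero, zero_mul] at h0
  exact hsat.2 (h0.2 hinit)
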